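/- Let $q=p^m$ be a prime power, let $u,r,\ell$ be positive integers with $u+2\ell<r+2$ and $u(r+1)\mid q-1$, and put $n=u(r+1)$. Then there are a primitive $n$-th root of unity $\alpha\in\mathbb F_q$ and a cyclic code $\mathcal C\subseteq\mathbb F_q^n$ whose defining set (the set of $j\in\{0,\ldots,n-1\}$ such that $\alpha^j$ is a zero of the generator polynomial of $\mathcal C$) is $\{i(r+1)+1: 0\le i\le u-1\}\cup\{1,\ldots,\ell\}$, such that $\mathcal C^{\perp}\subsetneq\mathcal C$, where $\perp$ is the Euclidean dual, such that $\mathcal C$ has locality $r$ (every coordinate lies in the support of a word of $\mathcal C^\perp$ of Hamming weight at most $r+1$), and such that the following holds. On $(\mathbb C^q)^{\otimes n}$ with orthonormal basis $\{|\mathbf z\rangle:\mathbf z\in\mathbb F_q^n\}$ let $X(\mathbf a)|\mathbf z\rangle=|\mathbf z+\mathbf a\rangle$ and $Z(\mathbf b)|\mathbf z\rangle=\xi_p^{\operatorname{tr}(\mathbf b\cdot\mathbf z)}|\mathbf z\rangle$, where $\xi_p=e^{2\pi\sqrt{-1}/p}$ and $\operatorname{tr}$ is the trace from $\mathbb F_q$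 to $\mathbb F_p$. The support of the error operator $\xi_p^iX(\mathbf a)Z(\mathbf b)$ is $\{j: a_j\ne0\text{ or }b_j\neq 0\}$, and its weight is the size of its support. Then $G=\{X(\mathbf a)Z(\mathbf b):\mathbf a,\mathbf b\in\mathcal C^\perp\}$ is an abelian group, and the stabilizer code $\mathcal Q=\{|\varphi\rangle : E|\varphi\rangle=|\varphi\rangle\text{ for all }E\in G\}$ of this group (the CSS code of $\mathcal C$) has the following properties. 1. $\mathcal Q$ is a $[[n,\kappa,\delta]]_q$ quantum code with $\kappa=u(r-1)-2(\ell-1)$ and $\delta=\ell+1$. That is, $\dim_{\mathbb C}\mathcal Q=q^{\kappa}$, and $\mathcal Q$ has minimum distance exactly $\delta$: it detects every error operator of weight less than $\delta$ but fails to detect some error operator of weight $\delta$. Here $\mathcal Q$ detects $E$ if there is $\lambda\in\mathbb C$ with $\langle\varphi|E|\psi\rangle=\lambda\langle\varphi|\psi\rangle$ for all $|\varphi\rangle,|\psi\rangle\in\mathcal Q$. 2. $\mathcal Q$ has locality $r$: for each $i\in\{1,\ldots,n\}$ there are $E_1=X(\mathbf a)Z(\mathbf b)\in G$ and $E_2=X(\mathbf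 x)Z(\mathbf y)\in G$ with $(a_i,b_i)=(1,0)$, $(x_i,y_i)=(0,1)$, and such that the union of the supports of $E_1$ and $E_2$ has at most $r+1$ elements (position $i$ and at most $r$ others). 3. $\mathcal Q$ meets the Singleton-like bound $2\delta\le n-\kappa-2\lceil\kappa/r\rceil+4$ with equality, i.e. $2\delta=n-\kappa-2\lceil\kappa/r\rceil+4$. -/

import Mathlib

open Polynomial

noncomputable section

namespace QLRC

/-! ### Classical linear codes -/

section Classical

variable {F : Type*} [Field F] {n : ℕ}

/-- The Euclidean dual of a linear code. -/
def dualCode (C : Submodule F (Fin n → F)) : Submodule F (Fin n → F) where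
  carrier := {a | ∀ c ∈ C, ∑ i, a i * c i = 0}
  zero_mem' := by
    intro c _
    simp
  add_mem' := by
    intro a b ha hb c hc
    have h1 := ha c hc
    have h2 := hb c hc
    simp only [Pi.add_apply, add_mul, Finset.sum_add_distrib, h1, h2, add_zero]
  smul_mem' := by
    intro t a ha c hc
    have h1 := ha c hc
    simp only [Pi.smul_apply, smul_eq_mul, mul_assoc, ← Finset.mul_sum, h1, mul_zero]

open Classical in
/-- The support of a vector. -/
def supp (c : Fin n → F) : Finset (Fin n) := Finset.univ.filter fun i => c i ≠ 0

/-- A linear code has (classical) locality `r` if every coordinate is covered by a dual codeword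
of weight at most `r + 1`. -/
def HasLocality (C : Submodule F (Fin n → F)) (r : ℕ) : Prop :=
  ∀ i : Fin n, ∃ c ∈ dualCode C, (supp c).card ≤ r + 1 ∧ i ∈ supp c

/-- A linear code is cyclic if it is closed under
`(c₀, c₁, …, cₙ₋₁) ↦ (cₙ₋₁, c₀, …, cₙ₋₂)`; here `finRotate n` is `i ↦ i + 1` modulo `n`. -/
def IsCyclic (C : Submodule F (Fin n → F)) : Prop :=
  ∀ c ∈ C, (fun i => c ((finRotate n).symm i)) ∈ C

/-- The polynomial `c₀ + c₁ x + ⋯ + cₙ₋₁ xⁿ⁻¹` of a word. -/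
def wordPoly (c : Fin n → F) : F[X] := ∑ i : Fin n, Polynomial.C (c i) * X ^ (i : ℕ)

/-- `g` is the generator polynomial of `C`: it is monic, divides `xⁿ - 1`, and `C`, seen in
`F[x] / (xⁿ - 1)`, is the ideal generated by `g`. -/
def IsGeneratorPoly (C : Submodule F (Fin n → F)) (g : F[X]) : Prop :=
  g.Monic ∧ g ∣ X ^ n - 1 ∧ ∀ c : Fin n → F, c ∈ C ↔ g ∣ wordPoly c

/-- `C` is a cyclic code whose defining set with respect to the primitive `n`-th root of unity
`α` of `F` is `D`: `D` consists of the exponents `i` in `{0, …, n - 1}` for which `α ^ i` is a zero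
of the generator polynomial. -/
def IsCyclicWithDefiningSet (C : Submodule F (Fin n → F)) (α : F) (D : Set ℕ) : Prop :=
  IsPrimitiveRoot α n ∧ IsCyclic C ∧
    ∃ g : F[X], IsGeneratorPoly C g ∧ D = {i : ℕ | i < n ∧ g.eval (α ^ i) = 0}

end Classical

/-! ### Quantum error operators and stabilizer codes -/

section Quantum

/-- The state space `(ℂ^q)^{⊗ n}`, as the Hilbert space with orthonormal basis `|z⟩`, `z ∈ F ^ n`. -/
abbrev Qudits (F : Type*) [Field F] [Fintype F] (n : ℕ) : Type _ := EuclideanSpace ℂ (Fin n → F)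

variable {F : Type*} [Field F] [Fintype F] {n : ℕ}

/-- The operator `X(a)`, `|z⟩ ↦ |z + a⟩`. -/
def opX (a : Fin n → F) : Qudits F n ≃ₗ[ℂ] Qudits F n where
  toFun φ := WithLp.toLp 2 fun z => φ (z - a)
  invFun φ := WithLp.toLp 2 fun z => φ (z + a)
  map_add' := by
    intro φ ψ
    ext z
    simp
  map_smul' := by
    intro t φ
    ext z
    simp
  left_inv := by
    intro φ
    ext z
    simp
  right_inv := by
    intro φ
    ext z
    simp

open Classical in
theorem opX_single (a z : Fin n → F) :
    opX a (EuclideanSpace.single z (1 : ℂ)) = EuclideanSpace.single (z + a) (1 : ℂ) := by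
  ext w
  simp [opX, PiLp.single_apply, sub_eq_iff_eq_add]

/-- The number `ξ_p ^ tr(t)` with `ξ_p = exp(2πi/p)` and `tr` the trace from `F` to `𝔽_p`. -/
def traceChar (p : ℕ) [Fact p.Prime] [Algebra (ZMod p) F] (t : F) : ℂ :=
  ZMod.stdAddChar (Algebra.trace (ZMod p) F t)

theorem traceChar_neg_mul {K : Type*} [Field K] (p : ℕ) [Fact p.Prime] [Algebra (ZMod p) K]
    (t : K) :
    traceChar p (-t) * traceChar p t = 1 := by
  simp [traceChar, ← AddChar.map_add_eq_mul]

/-- The operator `Z(b)`, `|z⟩ ↦ ξ_p ^ tr(⟨b, z⟩) |z⟩`. -/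
def opZ (p : ℕ) [Fact p.Prime] [Algebra (ZMod p) F] (b : Fin n → F) :
    Qudits F n ≃ₗ[ℂ] Qudits F n where
  toFun φ := WithLp.toLp 2 fun z => traceChar p (∑ i, b i * z i) * φ z
  invFun φ := WithLp.toLp 2 fun z => traceChar p (-∑ i, b i * z i) * φ z
  map_add' := by
    intro φ ψ
    ext z
    simp [mul_add]
  map_smul' := by
    intro t φ
    ext z
    simp [mul_left_comm]
  left_inv := by
    intro φ
    ext z
    simp [← mul_assoc, traceChar_neg_mul]
  right_inv := by
    intro φ
    ext z
    have h := traceChar_neg_mul p (∑ i, b i * z i)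
    rw [mul_comm] at h
    simp [← mul_assoc, h]

theorem stdAddChar_ne_zero (p : ℕ) [Fact p.Prime] (i : ZMod p) :
    (ZMod.stdAddChar i : ℂ) ≠ 0 := by
  intro h
  have h1 : (ZMod.stdAddChar (i + -i) : ℂ) = 1 := by simp
  rw [AddChar.map_add_eq_mul, h, zero_mul] at h1
  exact zero_ne_one h1

/-- The error operator `ξ_p ^ i X(a) Z(b)`. -/
def errorOp (p : ℕ) [Fact p.Prime] [Algebra (ZMod p) F] (i : ZMod p) (a b : Fin n → F) :
    Qudits F n ≃ₗ[ℂ] Qudits F n :=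
  LinearEquiv.smulOfNeZero ℂ (Qudits F n) (ZMod.stdAddChar i : ℂ) (stdAddChar_ne_zero p i) *
    (opX a * opZ p b)

open Classical in
/-- The support of the error operator `ξ_p ^ i X(a) Z(b)`. -/
def errorSupp (a b : Fin n → F) : Finset (Fin n) :=
  Finset.univ.filter fun i => a i ≠ 0 ∨ b i ≠ 0

/-- `G` is an abelian group of quantum error operators. -/
def IsStabilizerGroup (p : ℕ) [Fact p.Prime] [Algebra (ZMod p) F]
    (G : Subgroup (Qudits F n ≃ₗ[ℂ] Qudits F n)) : Prop :=
  (∀ E ∈ G, ∃ (i : ZMod p) (a b : Fin n → F), E = errorOp p i a b) ∧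
    ∀ E ∈ G, ∀ E' ∈ G, E * E' = E' * E

/-- The code `Q(G)` of the states that are fixed by every element of `G`. -/
def stabilizerCode (G : Subgroup (Qudits F n ≃ₗ[ℂ] Qudits F n)) : Submodule ℂ (Qudits F n) where
  carrier := {φ | ∀ E ∈ G, E φ = φ}
  zero_mem' := by
    intro E _
    simp
  add_mem' := by
    intro φ ψ hφ hψ E hE
    rw [map_add, hφ E hE, hψ E hE]
  smul_mem' := by
    intro t φ hφ E hE
    rw [map_smul, hφ E hE]

/-- `G` is the stabilizer group `{X(a) Z(b) : a ∈ C₁^⊥, b ∈ C₂^⊥}` of the CSS construction. -/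
def IsCSSGroup (p : ℕ) [Fact p.Prime] [Algebra (ZMod p) F] (C₁ C₂ : Submodule F (Fin n → F))
    (G : Subgroup (Qudits F n ≃ₗ[ℂ] Qudits F n)) : Prop :=
  (G : Set (Qudits F n ≃ₗ[ℂ] Qudits F n)) =
    {E | ∃ a ∈ dualCode C₁, ∃ b ∈ dualCode C₂, E = errorOp p 0 a b}

/-- The quantum code `Q` detects the operator `E` (Knill–Laflamme). -/
def Detects (Q : Submodule ℂ (Qudits F n)) (E : Qudits F n ≃ₗ[ℂ] Qudits F n) : Prop :=
  ∃ t : ℂ, ∀ φ ∈ Q, ∀ ψ ∈ Q, inner ℂ φ (E ψ) = t * inner ℂ φ ψ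

/-- The quantum code `Q` has minimum distance exactly `δ`: it detects every error operator of
weight less than `δ`, but not every one of weight `δ`. (Codes of dimension at most one detect
everything and have no minimum distance in this sense.) -/
def HasMinDist (p : ℕ) [Fact p.Prime] [Algebra (ZMod p) F] (Q : Submodule ℂ (Qudits F n))
    (δ : ℕ) : Prop :=
  (∀ (i : ZMod p) (a b : Fin n → F), (errorSupp a b).card < δ → Detects Q (errorOp p i a b)) ∧
    ∃ (i : ZMod p) (a b : Fin n → F), (errorSupp a b).card = δ ∧ ¬ Detects Q (errorOp p i a b)

/-- `Q` is an `[[n, κ, δ]]_q` quantum code, where `q` is the cardinality of `F`. -/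
def HasParameters (p : ℕ) [Fact p.Prime] [Algebra (ZMod p) F] (Q : Submodule ℂ (Qudits F n))
    (κ δ : ℕ) : Prop :=
  Module.finrank ℂ Q = Fintype.card F ^ κ ∧ HasMinDist p Q δ

/-- The stabilizer code of `G` is locally recoverable with locality `r`: for every position `i`
there are stabilizers `X(a) Z(b)` and `X(x) Z(y)` that act at `i` as `X(1)` and as `Z(1)`, and that
together involve at most `r` positions besides `i`, hence at most `r + 1` positions. -/
def HasQuantumLocality (p : ℕ) [Fact p.Prime] [Algebra (ZMod p) F]
    (G : Subgroup (Qudits F n ≃ₗ[ℂ] Qudits F n)) (r : ℕ) : Prop :=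
  ∀ i : Fin n, ∃ a b x y : Fin n → F,
    errorOp p 0 a b ∈ G ∧ errorOp p 0 x y ∈ G ∧
      (errorSupp a b ∪ errorSupp x y).card ≤ r + 1 ∧
      a i = 1 ∧ b i = 0 ∧ x i = 0 ∧ y i = 1

end Quantum

end QLRC

end

/-! Put n = u(r+1), let D be the defining set, and let C be the words whose polynomial vanishes at
α^j for j ∈ D. Then C^⊥ is spanned by the |D| = u+ℓ-1 independent words (α^{ij})_i. Two of them, for
j and j', are orthogonal unless n ∣ j+j'. Modulo r+1 every element of D lies in [1, ℓ], and 2ℓ <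
r+1, so C^⊥ ≤ C (`dualCode_zeroCode_le`, `not_dvd_add_of_mem_lrcZeros`).

Locality comes from the zeros i(r+1)+1: Lagrange interpolation at the powers of α^{r+1}, which has
order u, isolates one residue class of positions modulo u and yields a dual word supported on its
r+1 positions (`classWord_mem_dualCode`).

The zeros 1, …, ℓ give distance at least ℓ+1 by the BCH bound. The polynomial ∏_{j=1}^ℓ (x^u -
α^{uj}) has at most ℓ+1 terms and lies in C, but not in C^⊥: its value at 1, the pairing with the
all-one word of C, is nonzero.

The CSS states are the functions on C invariant under C^⊥, so κ = n - 2|D|. An error X(a)Z(b) with a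
or b outside C sends the code to an orthogonal subspace; if both lie in C and the weight is at most
ℓ, both vanish. The sparse word gives an undetected error of weight ℓ+1. Finally κ = ur - (u+2ℓ-2)
with u+2ℓ-2 < r, so ⌈κ/r⌉ = u, and the bound is attained. -/

namespace QLRC

/-! ### Cyclic codes given by their zeros -/

section Classical

variable {F : Type*} [Field F] {n : ℕ}

theorem mem_dualCode {C : Submodule F (Fin n → F)} {a : Fin n → F} :
    a ∈ dualCode C ↔ ∀ c ∈ C, ∑ i, a i * c i = 0 :=
  Iff.rfl

theorem dualCode_eq_orthogonal (C : Submodule F (Fin n → F)) :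
    dualCode C =
      LinearMap.BilinForm.orthogonal (dotProductBilin F F : LinearMap.BilinForm F (Fin n → F)) C := by
  ext a
  simp only [mem_dualCode, LinearMap.BilinForm.mem_orthogonal_iff]
  refine forall₂_congr fun c _ => ?_
  simp [dotProductBilin, dotProduct, mul_comm]

theorem dotProductBilin_nondegenerate :
    (dotProductBilin F F : LinearMap.BilinForm F (Fin n → F)).Nondegenerate := by
  classical
  constructor
  · intro x hx
    ext i
    simpa [dotProductBilin] using hx (Pi.single i 1)
  · intro x hx
    ext i
    simpa [dotProductBilin] using hx (Pi.single i 1)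

theorem dotProductBilin_isRefl :
    LinearMap.BilinForm.IsRefl (dotProductBilin F F : LinearMap.BilinForm F (Fin n → F)) := by
  intro x y h
  simpa [dotProductBilin, dotProduct_comm] using h

theorem dualCode_dualCode (C : Submodule F (Fin n → F)) : dualCode (dualCode C) = C := by
  rw [dualCode_eq_orthogonal, dualCode_eq_orthogonal]
  exact LinearMap.BilinForm.orthogonal_orthogonal dotProductBilin_nondegenerate
    dotProductBilin_isRefl C

theorem finrank_dualCode (C : Submodule F (Fin n → F)) :
    Module.finrank F (dualCode C) = n - Module.finrank F C := by
  rw [dualCode_eq_orthogonal,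
    LinearMap.BilinForm.finrank_orthogonal dotProductBilin_nondegenerate]
  simp

theorem notMem_dualCode {C : Submodule F (Fin n → F)} {a : Fin n → F} (h : a ∉ dualCode C) :
    ∃ c ∈ C, ∑ i, a i * c i ≠ 0 := by
  simpa [mem_dualCode] using h

theorem mem_supp {c : Fin n → F} {i : Fin n} : i ∈ supp c ↔ c i ≠ 0 := by
  simp only [supp, Finset.mem_filter, Finset.mem_univ, true_and]

/-- The word `(α ^ (i * j))ᵢ`, pairing with which evaluates the polynomial of a word at `α ^ j`. -/
def powWord (n : ℕ) (α : F) (j : ℕ) : Fin n → F := fun i => α ^ ((i : ℕ) * j)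

theorem wordPoly_eval (c : Fin n → F) (x : F) : (wordPoly c).eval x = ∑ i, c i * x ^ (i : ℕ) := by
  simp [wordPoly, eval_finsetSum]

theorem wordPoly_eval_pow (c : Fin n → F) (α : F) (j : ℕ) :
    (wordPoly c).eval (α ^ j) = ∑ i, c i * powWord n α j i := by
  simp only [wordPoly_eval, powWord, ← pow_mul]
  simp only [mul_comm j]

/-- The words whose polynomial vanishes at `α ^ j` for all `j ∈ D`. -/
def zeroCode (n : ℕ) (α : F) (D : Finset ℕ) : Submodule F (Fin n → F) :=
  dualCode (Submodule.span F (powWord n α '' D))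

theorem mem_zeroCode {α : F} {D : Finset ℕ} {c : Fin n → F} :
    c ∈ zeroCode n α D ↔ ∀ j ∈ D, (wordPoly c).eval (α ^ j) = 0 := by
  simp only [wordPoly_eval_pow]
  refine ⟨fun h j hj => h _ (Submodule.subset_span ⟨j, hj, rfl⟩), fun h w hw => ?_⟩
  induction hw using Submodule.span_induction with
  | mem x hx =>
    obtain ⟨j, hj, rfl⟩ := hx
    exact h j hj
  | zero => simp
  | add x y _ _ hx hy => simp [mul_add, Finset.sum_add_distrib, hx, hy]
  | smul t x _ hx => simp [mul_left_comm _ t, ← Finset.mul_sum, hx]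

theorem dualCode_zeroCode (α : F) (D : Finset ℕ) :
    dualCode (zeroCode n α D) = Submodule.span F (powWord n α '' D) :=
  dualCode_dualCode _

theorem linearIndependent_powWord {α : F} (hα : IsPrimitiveRoot α n) :
    LinearIndependent F fun j : Fin n => powWord n α j := by
  have hdet : (Matrix.vandermonde fun j : Fin n => α ^ (j : ℕ)).det ≠ 0 :=
    Matrix.det_vandermonde_ne_zero_iff.2 fun i j h => Fin.ext (hα.pow_inj i.2 j.2 h)
  have h : (fun j : Fin n => powWord n α j) = (Matrix.vandermonde fun j : Fin n => α ^ (j : ℕ)) := by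
    ext j i
    simp [powWord, Matrix.vandermonde, ← pow_mul, mul_comm]
  rw [h]
  exact Matrix.linearIndependent_rows_of_det_ne_zero hdet

theorem finrank_span_powWord {α : F} (hα : IsPrimitiveRoot α n) {D : Finset ℕ}
    (hD : ∀ j ∈ D, j < n) :
    Module.finrank F (Submodule.span F (powWord n α '' D)) = D.card := by
  have h : LinearIndependent F fun j : D => powWord n α j :=
    (linearIndependent_powWord hα).comp (fun j : D => (⟨j, hD j j.2⟩ : Fin n))
      fun i j hij => Subtype.ext (by simpa using hij)
  have hr : Set.range (fun j : D => powWord n α j) = powWord n α '' D := by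
    ext w
    simp
  rw [← hr, finrank_span_eq_card h, Fintype.card_coe]

theorem finrank_dualCode_zeroCode {α : F} (hα : IsPrimitiveRoot α n) {D : Finset ℕ}
    (hD : ∀ j ∈ D, j < n) : Module.finrank F (dualCode (zeroCode n α D)) = D.card := by
  rw [dualCode_zeroCode, finrank_span_powWord hα hD]

theorem finrank_zeroCode {α : F} (hα : IsPrimitiveRoot α n) {D : Finset ℕ}
    (hD : ∀ j ∈ D, j < n) : Module.finrank F (zeroCode n α D) = n - D.card := by
  rw [zeroCode, finrank_dualCode, finrank_span_powWord hα hD]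

theorem sum_pow_mul_eq_zero {α : F} (hα : IsPrimitiveRoot α n) {j : ℕ} (hj : ¬ n ∣ j) :
    ∑ i : Fin n, α ^ ((i : ℕ) * j) = 0 := by
  have h1 : α ^ j ≠ 1 := fun h => hj ((hα.pow_eq_one_iff_dvd j).1 h)
  have h2 : ∑ i : Fin n, α ^ ((i : ℕ) * j) = ∑ i ∈ Finset.range n, (α ^ j) ^ i := by
    rw [Finset.sum_range]
    simp only [← pow_mul, mul_comm]
  rw [h2, geom_sum_eq h1, ← pow_mul, mul_comm, pow_mul, hα.pow_eq_one]
  simp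

/-- `C^⊥ ≤ C` for a cyclic code whose defining set is disjoint from its negative. -/
theorem dualCode_zeroCode_le {α : F} (hα : IsPrimitiveRoot α n) {D : Finset ℕ}
    (hD : ∀ i ∈ D, ∀ j ∈ D, ¬ n ∣ i + j) : dualCode (zeroCode n α D) ≤ zeroCode n α D := by
  rw [dualCode_zeroCode, Submodule.span_le]
  rintro _ ⟨i, hi, rfl⟩
  refine mem_zeroCode.2 fun j hj => ?_
  rw [wordPoly_eval_pow, ← sum_pow_mul_eq_zero hα (hD i hi j hj)]
  simp [powWord, ← pow_add, mul_add]

/-- Later used to test membership in the dual: pairing with the all-one word evaluates a polynomial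
at 1. -/
theorem one_mem_zeroCode {α : F} (hα : IsPrimitiveRoot α n) {D : Finset ℕ}
    (hD : ∀ i ∈ D, ¬ n ∣ i) : (fun _ => 1 : Fin n → F) ∈ zeroCode n α D := by
  refine mem_zeroCode.2 fun j hj => ?_
  rw [wordPoly_eval_pow, ← sum_pow_mul_eq_zero hα (hD j hj)]
  simp [powWord]

theorem isCyclic_zeroCode {α : F} (hα : IsPrimitiveRoot α n) (D : Finset ℕ) :
    IsCyclic (zeroCode n α D) := by
  intro c hc
  refine mem_zeroCode.2 fun j hj => ?_
  have h := mem_zeroCode.1 hc j hj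
  rw [wordPoly_eval] at h ⊢
  rw [← Equiv.sum_comp (finRotate n)]
  -- A shift multiplies the value at α^j by α^j; the wrap-around agrees because (α^j)^n = 1.
  have key : ∀ i : Fin n, (α ^ j) ^ ((finRotate n i : Fin n) : ℕ) = α ^ j * (α ^ j) ^ (i : ℕ) := by
    intro i
    obtain _ | m := n
    · exact i.elim0
    rw [coe_finRotate, ← pow_succ']
    split_ifs with hi
    · subst hi
      rw [Fin.val_last, pow_zero, pow_right_comm, hα.pow_eq_one, one_pow]
    · rfl
  simp only [key, Equiv.symm_apply_apply]
  rw [Finset.sum_congr rfl fun i _ => mul_left_comm _ _ _, ← Finset.mul_sum, h, mul_zero]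

/-- The generator is the product of the factors x - α^j, which are pairwise coprime since exponents
below n give distinct powers of α. -/
theorem isCyclicWithDefiningSet_zeroCode {α : F} (hα : IsPrimitiveRoot α n) {D : Finset ℕ}
    (hD : ∀ j ∈ D, j < n) : IsCyclicWithDefiningSet (zeroCode n α D) α D := by
  have hdvd : ∀ f : F[X], ∏ j ∈ D, (X - C (α ^ j)) ∣ f ↔ ∀ j ∈ D, f.eval (α ^ j) = 0 := by
    intro f
    refine ⟨fun h j hj => dvd_iff_isRoot.1 (dvd_trans ?_ h),
      fun h => Finset.prod_dvd_of_coprime (fun i hi j hj hij => ?_)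
        fun j hj => dvd_iff_isRoot.2 (h j hj)⟩
    · exact Finset.dvd_prod_of_mem (fun j => X - C (α ^ j)) hj
    exact isCoprime_X_sub_C_of_isUnit_sub
      (sub_ne_zero.2 fun h => hij (hα.pow_inj (hD i hi) (hD j hj) h)).isUnit
  refine ⟨hα, isCyclic_zeroCode hα D, ∏ j ∈ D, (X - C (α ^ j)),
    ⟨monic_prod_of_monic _ _ fun j _ => monic_X_sub_C _, (hdvd _).2 fun j _ => ?_,
      fun c => mem_zeroCode.trans (hdvd _).symm⟩, ?_⟩
  · rw [eval_sub, eval_pow, eval_X, eval_one, pow_right_comm, hα.pow_eq_one, one_pow, sub_self]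
  · ext i
    simp only [Finset.mem_coe, Set.mem_ofPred_eq, eval_prod, eval_sub, eval_X, eval_C,
      Finset.prod_eq_zero_iff, sub_eq_zero]
    refine ⟨fun hi => ⟨hD i hi, i, hi, rfl⟩, ?_⟩
    rintro ⟨hi, j, hj, hij⟩
    rwa [hα.pow_inj hi (hD j hj) hij]

/-- Linearity extends vanishing power sums to all polynomials of low degree. A polynomial vanishing
at all unwanted nodes then isolates the remaining terms; both the BCH bound and the local dual words
arise this way. -/
theorem sum_mul_eval_eq_zero {ι : Type*} [Fintype ι] {w x : ι → F} {m : ℕ}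
    (h : ∀ j < m, ∑ i, w i * x i ^ j = 0) {f : F[X]} (hf : f.natDegree < m) :
    ∑ i, w i * f.eval (x i) = 0 := by
  simp only [eval_eq_sum_range, Finset.mul_sum]
  rw [Finset.sum_comm]
  refine Finset.sum_eq_zero fun j hj => ?_
  simp only [mul_left_comm _ (f.coeff j), ← Finset.mul_sum]
  rw [h j (by grind), mul_zero]

/-- The BCH bound for the defining set `{1, …, ℓ}`. -/
theorem eq_zero_of_card_supp_le {α : F} (hα : IsPrimitiveRoot α n) {D : Finset ℕ} {ℓ : ℕ}
    (hD : ∀ j, 1 ≤ j → j ≤ ℓ → j ∈ D) {c : Fin n → F} (hc : c ∈ zeroCode n α D)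
    (hw : (supp c).card ≤ ℓ) : c = 0 := by
  classical
  by_contra hne
  obtain ⟨k, hk⟩ := Function.ne_iff.1 hne
  have hks : k ∈ supp c := mem_supp.2 hk
  have hα0 : α ≠ 0 := hα.ne_zero (by rintro rfl; exact k.elim0)
  -- The weight α^i shifts exponents, so that j < ℓ corresponds to the zero α^(j+1). The polynomial
  -- kills the support except `k`, leaving a single nonzero term.
  have hsum := sum_mul_eval_eq_zero (w := fun i => c i * α ^ (i : ℕ))
    (x := fun i : Fin n => α ^ (i : ℕ)) (m := ℓ)
    (f := ∏ i ∈ (supp c).erase k, (X - C (α ^ (i : ℕ)))) ?_ ?_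
  · rw [Finset.sum_eq_single k] at hsum
    · simp only [eval_prod, mul_eq_zero, Finset.prod_eq_zero_iff, eval_sub, eval_X, eval_C] at hsum
      obtain (h | h) | ⟨i, hi, h⟩ := hsum
      · exact hk h
      · exact pow_ne_zero _ hα0 h
      · exact Finset.ne_of_mem_erase hi
          (Fin.ext (hα.pow_inj i.2 k.2 (sub_eq_zero.1 h).symm))
    · intro i _ hik
      by_cases hi : c i = 0
      · simp [hi]
      · have : i ∈ (supp c).erase k := Finset.mem_erase.2 ⟨hik, mem_supp.2 hi⟩
        rw [eval_prod, Finset.prod_eq_zero this (by simp), mul_zero]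
    · simp
  · intro j hj
    have := mem_zeroCode.1 hc (j + 1) (hD _ (by lia) (by lia))
    rw [wordPoly_eval] at this
    rw [← this]
    refine Finset.sum_congr rfl fun i _ => ?_
    ring
  · have := Finset.card_pos.2 ⟨k, hks⟩
    rw [natDegree_finsetProd_X_sub_C_eq_card, Finset.card_erase_of_mem hks]
    lia

/-- The restriction of `powWord n α 1` to a residue class modulo `u`. -/
def classWord (n : ℕ) (α : F) (u s : ℕ) : Fin n → F :=
  fun k => if (k : ℕ) % u = s then α ^ (k : ℕ) else 0

/-- With β = α^v of order u, the zeros say that the weights c_k α^k annihilate the first u powers of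
β^k. Since β^k depends only on k mod u, a polynomial of degree u-1 vanishing at every β^t except β^s
leaves only the class of s. -/
theorem classWord_mem_dualCode {u v : ℕ} (hu : 0 < u) {α : F} (hα : IsPrimitiveRoot α (u * v))
    (hv : 0 < v) {D : Finset ℕ} (hD : ∀ i < u, i * v + 1 ∈ D) {s : ℕ} (hs : s < u) :
    classWord (u * v) α u s ∈ dualCode (zeroCode (u * v) α D) := by
  classical
  intro c hc
  have hβ : IsPrimitiveRoot (α ^ v) u := hα.pow (by positivity) (mul_comm _ _)
  have hmod : ∀ k : ℕ, (α ^ v) ^ k = (α ^ v) ^ (k % u) := fun k => by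
    conv_lhs => rw [← Nat.div_add_mod k u, pow_add, pow_mul, hβ.pow_eq_one, one_pow, one_mul]
  set f : F[X] := ∏ t ∈ (Finset.range u).erase s, (X - C ((α ^ v) ^ t)) with hf
  have hfs : f.eval ((α ^ v) ^ s) ≠ 0 := by
    simp only [hf, eval_prod, eval_sub, eval_X, eval_C, ne_eq, Finset.prod_eq_zero_iff,
      Finset.mem_erase, Finset.mem_range, sub_eq_zero]
    rintro ⟨t, ⟨hts, ht⟩, h⟩
    exact hts (hβ.pow_inj ht hs h.symm)
  have hsum := sum_mul_eval_eq_zero (w := fun i => c i * α ^ (i : ℕ))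
    (x := fun i : Fin (u * v) => (α ^ v) ^ (i : ℕ)) (m := u) (f := f) ?_ ?_
  · refine (mul_eq_zero.1 ?_).resolve_left hfs
    rw [← hsum, Finset.mul_sum]
    refine Finset.sum_congr rfl fun k _ => ?_
    rw [hmod k, classWord]
    split_ifs with h
    · rw [h]
      ring
    · have : (k : ℕ) % u ∈ (Finset.range u).erase s :=
        Finset.mem_erase.2 ⟨h, Finset.mem_range.2 (Nat.mod_lt _ hu)⟩
      have hz : f.eval ((α ^ v) ^ ((k : ℕ) % u)) = 0 := by
        rw [hf, eval_prod]
        exact Finset.prod_eq_zero this (by rw [eval_sub, eval_X, eval_C, sub_self])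
      rw [hz, mul_zero, zero_mul, mul_zero]
  · intro j hj
    have := mem_zeroCode.1 hc _ (hD j hj)
    rw [wordPoly_eval] at this
    rw [← this]
    refine Finset.sum_congr rfl fun i _ => ?_
    ring
  · rw [hf, natDegree_finsetProd_X_sub_C_eq_card, Finset.card_erase_of_mem (Finset.mem_range.2 hs),
      Finset.card_range]
    exact Nat.sub_lt hu one_pos

theorem card_supp_classWord_le {u v : ℕ} (α : F) (s : ℕ) :
    (supp (classWord (u * v) α u s)).card ≤ v := by
  have h : Set.InjOn (fun k : Fin (u * v) => (k : ℕ) / u) (supp (classWord (u * v) α u s)) := by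
    intro k hk l hl hkl
    have hk' : (k : ℕ) % u = s := by
      by_contra h
      exact mem_supp.1 hk (if_neg h)
    have hl' : (l : ℕ) % u = s := by
      by_contra h
      exact mem_supp.1 hl (if_neg h)
    ext
    rw [← Nat.div_add_mod k u, ← Nat.div_add_mod l u, hk', hl']
    exact congrArg (fun t => u * t + s) hkl
  refine (Finset.card_le_card_of_injOn (t := Finset.range v) _ (fun k _ => ?_) h).trans (by simp)
  simpa using Nat.div_lt_of_lt_mul k.2

/-- The coefficients of `∏_{j=1}^ℓ (x^u - α^{uj})`, as a word. -/
noncomputable def sparseWord (n u ℓ : ℕ) (α : F) : Fin n → F :=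
  fun k => (expand F u (∏ j ∈ Finset.Icc 1 ℓ, (X - C ((α ^ u) ^ j)))).coeff k

/-- The degree u * ℓ is below n, so cutting off at n coefficients loses nothing. -/
theorem wordPoly_sparseWord {n u ℓ : ℕ} (α : F) (h : u * ℓ < n) :
    wordPoly (sparseWord n u ℓ α) = expand F u (∏ j ∈ Finset.Icc 1 ℓ, (X - C ((α ^ u) ^ j))) := by
  set f := expand F u (∏ j ∈ Finset.Icc 1 ℓ, (X - C ((α ^ u) ^ j))) with hf
  have hdeg : f.natDegree < n := by
    rw [hf, natDegree_expand, natDegree_finsetProd_X_sub_C_eq_card]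
    simpa [mul_comm] using h
  conv_rhs => rw [f.as_sum_range' n hdeg, Finset.sum_range]
  simp only [wordPoly, sparseWord, C_mul_X_pow_eq_monomial, ← hf]

theorem eval_wordPoly_sparseWord {n u ℓ : ℕ} (α x : F) (h : u * ℓ < n) :
    (wordPoly (sparseWord n u ℓ α)).eval x = ∏ j ∈ Finset.Icc 1 ℓ, (x ^ u - (α ^ u) ^ j) := by
  simp only [wordPoly_sparseWord α h, expand_eval, eval_prod, eval_sub, eval_X, eval_C]

theorem card_supp_sparseWord_le {n u ℓ : ℕ} (hu : 0 < u) (α : F) :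
    (supp (sparseWord n u ℓ α)).card ≤ ℓ + 1 := by
  set f := ∏ j ∈ Finset.Icc 1 ℓ, (X - C ((α ^ u) ^ j)) with hf
  have hdeg : f.natDegree = ℓ := by
    rw [hf, natDegree_finsetProd_X_sub_C_eq_card]
    simp
  have hk : ∀ k ∈ supp (sparseWord n u ℓ α), u ∣ (k : ℕ) ∧ (k : ℕ) / u ≤ ℓ := by
    intro k hk
    have hk : (expand F u f).coeff k ≠ 0 := mem_supp.1 hk
    rw [coeff_expand hu] at hk
    split_ifs at hk with hd
    · exact ⟨hd, hdeg ▸ le_natDegree_of_ne_zero hk⟩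
    · exact absurd rfl hk
  refine (Finset.card_le_card_of_injOn (t := Finset.range (ℓ + 1))
    (fun k : Fin n => (k : ℕ) / u) (fun k h => ?_) fun k h l h' hkl => ?_).trans (by simp)
  · simpa [Nat.lt_succ_iff] using (hk k h).2
  · exact Fin.ext ((Nat.div_left_inj (hk k h).1 (hk l h').1).1 hkl)

end Classical

/-! ### Error operators and the CSS code -/

section Quantum

section Support

variable {F : Type*} [Field F] {n : ℕ}

theorem mem_errorSupp {a b : Fin n → F} {i : Fin n} : i ∈ errorSupp a b ↔ a i ≠ 0 ∨ b i ≠ 0 := by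
  simp only [errorSupp, Finset.mem_filter, Finset.mem_univ, true_and]

theorem errorSupp_comm (a b : Fin n → F) : errorSupp a b = errorSupp b a := by
  ext i
  rw [mem_errorSupp, mem_errorSupp, or_comm]

theorem supp_subset_errorSupp (a b : Fin n → F) : supp a ⊆ errorSupp a b :=
  fun _ hi => mem_errorSupp.2 (Or.inl (mem_supp.1 hi))

theorem errorSupp_zero_right (a : Fin n → F) : errorSupp a 0 = supp a := by
  ext i
  simp [mem_errorSupp, mem_supp]

end Support

variable {F : Type*} [Field F] [Fintype F] {n : ℕ} (p : ℕ) [Fact p.Prime] [Algebra (ZMod p) F]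

theorem traceChar_add {K : Type*} [Field K] [Algebra (ZMod p) K] (s t : K) :
    traceChar p (s + t) = traceChar p s * traceChar p t := by
  simp [traceChar, AddChar.map_add_eq_mul]

theorem traceChar_zero {K : Type*} [Field K] [Algebra (ZMod p) K] : traceChar p (0 : K) = 1 := by
  simp [traceChar]

/-- The trace is onto, hence nonzero. The free scalar `s` can be absorbed into a word of a linear
code, so trace duality reduces to Euclidean duality. -/
theorem exists_traceChar_ne_one {t : F} (ht : t ≠ 0) : ∃ s : F, traceChar p (s * t) ≠ 1 := by
  obtain ⟨x, hx⟩ := Algebra.trace_surjective (ZMod p) F 1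
  refine ⟨x * t⁻¹, fun h => ?_⟩
  rw [inv_mul_cancel_right₀ ht, traceChar, hx] at h
  have := ZMod.injective_stdAddChar (h.trans (AddChar.map_zero_eq_one _).symm)
  exact one_ne_zero this

theorem errorOp_apply (i : ZMod p) (a b : Fin n → F) (φ : Qudits F n) (z : Fin n → F) :
    errorOp p i a b φ z =
      ZMod.stdAddChar i * (traceChar p (∑ k, b k * (z - a) k) * φ (z - a)) :=
  rfl

theorem errorOp_zero_apply (a b : Fin n → F) (φ : Qudits F n) (z : Fin n → F) :
    errorOp p 0 a b φ z = traceChar p (∑ k, b k * (z - a) k) * φ (z - a) := by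
  simp [errorOp_apply]

variable {p} in
-- Moving Z(b) past X(a') costs the phase ξ^tr(b·a'), which is trivial here. For words of C^⊥ ≤ C
-- this always applies, giving commutativity and closure without phases.
theorem errorOp_mul_of_sum_eq_zero {a b a' b' : Fin n → F} (h : ∑ k, b k * a' k = 0) :
    errorOp p 0 a b * errorOp p 0 a' b' = errorOp p 0 (a + a') (b + b') := by
  ext φ z
  rw [LinearEquiv.mul_apply, errorOp_zero_apply, errorOp_zero_apply, errorOp_zero_apply,
    ← mul_assoc, ← traceChar_add, ← sub_sub]
  congr 2
  simp only [Pi.add_apply, add_mul, Finset.sum_add_distrib]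
  congr 1
  rw [← sub_eq_zero, ← Finset.sum_sub_distrib, ← h]
  refine Finset.sum_congr rfl fun k _ => ?_
  simp only [Pi.sub_apply]
  ring

theorem errorOp_zero_zero : errorOp p 0 (0 : Fin n → F) 0 = 1 := by
  ext φ z
  simp [errorOp_zero_apply, traceChar_zero]

/-- The stabilizer group `{X(a) Z(b) : a, b ∈ C^⊥}` of a code with `C^⊥ ≤ C`. -/
def cssGroup (C : Submodule F (Fin n → F)) (hC : dualCode C ≤ C) :
    Subgroup (Qudits F n ≃ₗ[ℂ] Qudits F n) where
  carrier := {E | ∃ a ∈ dualCode C, ∃ b ∈ dualCode C, E = errorOp p 0 a b}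
  one_mem' := ⟨0, zero_mem _, 0, zero_mem _, (errorOp_zero_zero p).symm⟩
  mul_mem' := by
    rintro _ _ ⟨a, ha, b, hb, rfl⟩ ⟨a', ha', b', hb', rfl⟩
    exact ⟨_, add_mem ha ha', _, add_mem hb hb', errorOp_mul_of_sum_eq_zero (hb _ (hC ha'))⟩
  inv_mem' := by
    rintro _ ⟨a, ha, b, hb, rfl⟩
    refine ⟨_, neg_mem ha, _, neg_mem hb, inv_eq_of_mul_eq_one_right ?_⟩
    rw [errorOp_mul_of_sum_eq_zero (hb _ (hC (neg_mem ha))), add_neg_cancel, add_neg_cancel,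
      errorOp_zero_zero]

variable {C : Submodule F (Fin n → F)} (hC : dualCode C ≤ C)

theorem isCSSGroup_cssGroup : IsCSSGroup p C C (cssGroup p C hC) :=
  rfl

theorem isStabilizerGroup_cssGroup : IsStabilizerGroup p (cssGroup p C hC) := by
  refine ⟨?_, ?_⟩
  · rintro _ ⟨a, _, b, _, rfl⟩
    exact ⟨0, a, b, rfl⟩
  · rintro _ ⟨a, ha, b, hb, rfl⟩ _ ⟨a', ha', b', hb', rfl⟩
    rw [errorOp_mul_of_sum_eq_zero (hb _ (hC ha')), errorOp_mul_of_sum_eq_zero (hb' _ (hC ha)),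
      add_comm a, add_comm b]

/-- The states of the CSS code are the functions supported on `C` and invariant under `C^⊥`. -/
theorem mem_stabilizerCode_cssGroup {φ : Qudits F n} :
    φ ∈ stabilizerCode (cssGroup p C hC) ↔
      (∀ z ∉ C, φ z = 0) ∧ ∀ a ∈ dualCode C, ∀ z, φ (z - a) = φ z := by
  constructor
  · intro h
    refine ⟨fun z hz => ?_, fun a ha z => ?_⟩
    -- A point outside C = C^⊥⊥ pairs nontrivially with a dual word; a suitable multiple of that
    -- word gives a Z-stabilizer acting at `z` by a phase other than 1.
    · rw [← dualCode_dualCode C] at hz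
      obtain ⟨c, hc, hcz⟩ := notMem_dualCode hz
      obtain ⟨s, hs⟩ := exists_traceChar_ne_one p hcz
      have h1 := congrArg (fun ψ : Qudits F n => ψ z)
        (h _ ⟨0, zero_mem _, s • c, Submodule.smul_mem _ s hc, rfl⟩)
      have h2 : ∑ k, (s • c) k * z k = s * ∑ k, z k * c k := by
        rw [Finset.mul_sum]
        refine Finset.sum_congr rfl fun k _ => ?_
        simp only [Pi.smul_apply, smul_eq_mul]
        ring
      simp only [errorOp_zero_apply, sub_zero, h2] at h1
      by_contra h3
      exact hs (mul_right_cancel₀ h3 (h1.trans (one_mul _).symm))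
    · have h1 := congrArg (fun ψ : Qudits F n => ψ z) (h _ ⟨a, ha, 0, zero_mem _, rfl⟩)
      simpa [errorOp_zero_apply, traceChar_zero] using h1
  · rintro ⟨h1, h2⟩ _ ⟨a, ha, b, hb, rfl⟩
    ext z
    rw [errorOp_zero_apply, h2 a ha]
    by_cases hz : z ∈ C
    · rw [hb _ (sub_mem hz (hC ha)), traceChar_zero, one_mul]
    · rw [h1 z hz, mul_zero]

open Classical in
/-- The state of the CSS code with prescribed values on the cosets of `C^⊥` in `C`. -/
noncomputable def cosetState (C : Submodule F (Fin n → F)) :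
    (C ⧸ (dualCode C).submoduleOf C → ℂ) →ₗ[ℂ] Qudits F n where
  toFun h := WithLp.toLp 2 fun z =>
    if hz : z ∈ C then h (Submodule.Quotient.mk ⟨z, hz⟩) else 0
  map_add' := by
    intro g h
    ext z
    by_cases hz : z ∈ C <;> simp [hz]
  map_smul' := by
    intro t h
    ext z
    by_cases hz : z ∈ C <;> simp [hz]

theorem cosetState_of_mem (h : C ⧸ (dualCode C).submoduleOf C → ℂ) (z : C) :
    cosetState C h z = h (Submodule.Quotient.mk z) := by
  simp [cosetState]

theorem cosetState_of_notMem (h : C ⧸ (dualCode C).submoduleOf C → ℂ) {z : Fin n → F}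
    (hz : z ∉ C) : cosetState C h z = 0 := by
  simp [cosetState, hz]

theorem cosetState_injective : Function.Injective (cosetState C) := by
  intro g h hgh
  ext x
  obtain ⟨z, rfl⟩ := Submodule.Quotient.mk_surjective _ x
  exact (cosetState_of_mem g z).symm.trans
    ((congrArg (fun ψ : Qudits F n => ψ z) hgh).trans (cosetState_of_mem h z))

theorem range_cosetState :
    LinearMap.range (cosetState C) = stabilizerCode (cssGroup p C hC) := by
  ext φ
  rw [mem_stabilizerCode_cssGroup]
  constructor
  · rintro ⟨h, rfl⟩
    refine ⟨fun z hz => cosetState_of_notMem h hz, fun a ha z => ?_⟩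
    by_cases hz : z ∈ C
    · have h1 := cosetState_of_mem h ⟨z, hz⟩
      have h2 := cosetState_of_mem h ⟨z - a, sub_mem hz (hC ha)⟩
      refine h2.trans (Eq.trans (congrArg h ?_) h1.symm)
      rw [Submodule.Quotient.eq, Submodule.submoduleOf, Submodule.mem_comap]
      simpa using ha
    · rw [cosetState_of_notMem h hz,
        cosetState_of_notMem h fun hza => hz (by simpa using add_mem hza (hC ha))]
  · rintro ⟨h1, h2⟩
    have hsurj := Submodule.Quotient.mk_surjective ((dualCode C).submoduleOf C)
    -- Any choice of coset representatives will do, by invariance under C^⊥.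
    refine ⟨fun x => φ (Function.surjInv hsurj x : C), ?_⟩
    ext z
    by_cases hz : z ∈ C
    · refine (cosetState_of_mem _ ⟨z, hz⟩).trans ?_
      have h3 := Function.surjInv_eq hsurj (Submodule.Quotient.mk ⟨z, hz⟩)
      have h4 := h2 _ (Submodule.mem_comap.1 ((Submodule.Quotient.eq _).1 h3.symm)) z
      simpa using h4
    · rw [cosetState_of_notMem _ hz, h1 z hz]

theorem finrank_stabilizerCode_cssGroup :
    Module.finrank ℂ (stabilizerCode (cssGroup p C hC)) =
      Fintype.card F ^ (Module.finrank F C - Module.finrank F (dualCode C)) := by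
  classical
  have := Fintype.ofFinite (C ⧸ (dualCode C).submoduleOf C)
  rw [← range_cosetState, LinearMap.finrank_range_of_inj cosetState_injective,
    Module.finrank_fintype_fun_eq_card, Module.card_eq_pow_finrank (K := F),
    Submodule.finrank_quotient, (Submodule.submoduleOfEquivOfLe hC).finrank_eq]

theorem inner_errorOp (i : ZMod p) (a b : Fin n → F) (φ ψ : Qudits F n) :
    inner ℂ φ (errorOp p i a b ψ) = ∑ z, errorOp p i a b ψ z * star (φ z) := by
  simp [PiLp.inner_apply]

/-- The translate of C by `a` is disjoint from C, so all inner products vanish. -/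
theorem detects_of_notMem_left (i : ZMod p) {a b : Fin n → F} (ha : a ∉ C) :
    Detects (stabilizerCode (cssGroup p C hC)) (errorOp p i a b) := by
  refine ⟨0, fun φ hφ ψ hψ => ?_⟩
  rw [mem_stabilizerCode_cssGroup] at hφ hψ
  rw [zero_mul, inner_errorOp]
  refine Finset.sum_eq_zero fun z _ => ?_
  by_cases hz : z ∈ C
  · rw [errorOp_apply, hψ.1 (z - a) fun h => ha (by simpa using sub_mem hz h)]
    simp
  · rw [hφ.1 z hz, star_zero, mul_zero]

theorem detects_of_notMem_right (i : ZMod p) {a b : Fin n → F} (hb : b ∉ C) :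
    Detects (stabilizerCode (cssGroup p C hC)) (errorOp p i a b) := by
  refine ⟨0, fun φ hφ ψ hψ => ?_⟩
  rw [mem_stabilizerCode_cssGroup] at hφ hψ
  rw [zero_mul, inner_errorOp]
  rw [← dualCode_dualCode C] at hb
  obtain ⟨c, hc, hbc⟩ := notMem_dualCode hb
  obtain ⟨s, hs⟩ := exists_traceChar_ne_one p hbc
  have hsc : s • c ∈ dualCode C := Submodule.smul_mem _ s hc
  set S := ∑ z, errorOp p i a b ψ z * star (φ z) with hS
  -- Translating the summation variable by s • c ∈ C^⊥ fixes both states but multiplies the sum by a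
  -- phase other than 1, so the sum is 0.
  have h : S = traceChar p (s * ∑ k, b k * c k) * S := by
    conv_lhs => rw [hS, ← Equiv.sum_comp (Equiv.addRight (s • c))]
    rw [hS, Finset.mul_sum]
    refine Finset.sum_congr rfl fun z _ => ?_
    have h1 : φ (z + s • c) = φ z := by
      rw [← hφ.2 _ hsc (z + s • c), add_sub_cancel_right]
    have h2 : ψ (z + s • c - a) = ψ (z - a) := by
      rw [← hψ.2 _ hsc (z + s • c - a), add_sub_right_comm, add_sub_cancel_right]
    have h3 : ∑ k, b k * (z + s • c - a) k = s * ∑ k, b k * c k + ∑ k, b k * (z - a) k := by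
      rw [Finset.mul_sum, ← Finset.sum_add_distrib]
      refine Finset.sum_congr rfl fun k _ => ?_
      simp only [Pi.sub_apply, Pi.add_apply, Pi.smul_apply, smul_eq_mul]
      ring
    rw [Equiv.coe_addRight, errorOp_apply, errorOp_apply, h1, h2, h3, traceChar_add]
    ring
  by_contra h0
  exact hs (mul_right_cancel₀ h0 (h.symm.trans (one_mul _).symm))

theorem detects_errorOp_zero (Q : Submodule ℂ (Qudits F n)) (i : ZMod p) :
    Detects Q (errorOp p i 0 0) := by
  refine ⟨ZMod.stdAddChar i, fun φ _ ψ _ => ?_⟩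
  rw [inner_errorOp, PiLp.inner_apply, Finset.mul_sum]
  refine Finset.sum_congr rfl fun z _ => ?_
  simp [errorOp_apply, traceChar_zero, mul_assoc]

/-- A bit-flip error by a word of `C` outside `C^⊥` moves code states to other code states, and is
not detected. -/
theorem not_detects_of_mem {a : Fin n → F} (ha : a ∈ C) (ha' : a ∉ dualCode C) :
    ¬ Detects (stabilizerCode (cssGroup p C hC)) (errorOp p 0 a 0) := by
  classical
  rintro ⟨t, ht⟩
  -- Indicators of C^⊥ and of the disjoint coset a + C^⊥: orthogonal code states with X(a) S = T.
  -- Detection would force ⟨T, T⟩ = 0.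
  let S : Qudits F n := WithLp.toLp 2 fun z => if z ∈ dualCode C then 1 else 0
  let T : Qudits F n := WithLp.toLp 2 fun z => if z - a ∈ dualCode C then 1 else 0
  have hS : S ∈ stabilizerCode (cssGroup p C hC) := by
    refine (mem_stabilizerCode_cssGroup p hC).2 ⟨fun z hz => if_neg fun h => hz (hC h),
      fun c hc z => ?_⟩
    simp [S, Submodule.sub_mem_iff_left _ hc]
  have hT : T ∈ stabilizerCode (cssGroup p C hC) := by
    refine (mem_stabilizerCode_cssGroup p hC).2
      ⟨fun z hz => if_neg fun h => hz (by simpa using add_mem (hC h) ha), fun c hc z => ?_⟩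
    simp [T, sub_right_comm z c a, Submodule.sub_mem_iff_left _ hc]
  have hTS : inner ℂ T S = 0 := by
    rw [PiLp.inner_apply]
    refine Finset.sum_eq_zero fun z _ => ?_
    by_cases hz : z ∈ dualCode C
    · have : z - a ∉ dualCode C := fun h => ha' (by simpa using sub_mem hz h)
      simp [T, this]
    · simp [S, hz]
  have hE : errorOp p 0 a 0 S = T := by
    ext z
    simp [errorOp_zero_apply, traceChar_zero, S, T]
  have h := ht T hT S hS
  rw [hTS, mul_zero, hE, inner_self_eq_zero] at h
  have := congrArg (fun ψ : Qudits F n => ψ a) h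
  simp [T] at this

/-- The minimum distance of the CSS code of `C` is the minimum distance of `C`, if some word of
minimum weight lies outside `C^⊥`. -/
theorem hasMinDist_cssGroup {ℓ : ℕ} (hd : ∀ c ∈ C, (supp c).card ≤ ℓ → c = 0) {a : Fin n → F}
    (ha : a ∈ C) (ha' : a ∉ dualCode C) (hw : (supp a).card = ℓ + 1) :
    HasMinDist p (stabilizerCode (cssGroup p C hC)) (ℓ + 1) := by
  refine ⟨fun i x y hxy => ?_, 0, a, 0, by rw [errorSupp_zero_right, hw],
    not_detects_of_mem p hC ha ha'⟩
  by_cases hx : x ∈ C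
  · by_cases hy : y ∈ C
    · have hx0 := hd x hx
        ((Finset.card_le_card (supp_subset_errorSupp x y)).trans (Nat.lt_succ_iff.1 hxy))
      have hy0 := hd y hy ((Finset.card_le_card (supp_subset_errorSupp y x)).trans
        (errorSupp_comm x y ▸ Nat.lt_succ_iff.1 hxy))
      rw [hx0, hy0]
      exact detects_errorOp_zero p _ i
    · exact detects_of_notMem_right p hC i hy
  · exact detects_of_notMem_left p hC i hx

/-- One normalised dual word serves for both the X- and the Z-stabilizer, so the two supports
coincide. -/
theorem hasQuantumLocality_cssGroup {r : ℕ} (h : HasLocality C r) :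
    HasQuantumLocality p (cssGroup p C hC) r := by
  intro i
  obtain ⟨c, hc, hcard, hi⟩ := h i
  have hi := mem_supp.1 hi
  have hc' : (c i)⁻¹ • c ∈ dualCode C := Submodule.smul_mem _ _ hc
  refine ⟨(c i)⁻¹ • c, 0, 0, (c i)⁻¹ • c, ⟨_, hc', _, zero_mem _, rfl⟩,
    ⟨_, zero_mem _, _, hc', rfl⟩, ?_, by simp [hi], rfl, rfl, by simp [hi]⟩
  rw [errorSupp_comm 0, Finset.union_self, errorSupp_zero_right]
  refine (Finset.card_le_card fun k hk => ?_).trans hcard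
  rw [mem_supp] at hk ⊢
  exact right_ne_zero_of_mul hk

end Quantum

/-! ### Arithmetic of the defining set and the resulting code -/

/-- The defining set `{i (r + 1) + 1 : i < u} ∪ {1, …, ℓ}`. -/
def lrcZeros (u r ℓ : ℕ) : Finset ℕ :=
  (Finset.range u).image (fun i => i * (r + 1) + 1) ∪ Finset.Icc 1 ℓ

theorem mem_lrcZeros {u r ℓ j : ℕ} :
    j ∈ lrcZeros u r ℓ ↔ (∃ i < u, i * (r + 1) + 1 = j) ∨ 1 ≤ j ∧ j ≤ ℓ := by
  simp [lrcZeros]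

theorem coe_lrcZeros (u r ℓ : ℕ) :
    (lrcZeros u r ℓ : Set ℕ) = {j : ℕ | ∃ i : ℕ, i < u ∧ j = i * (r + 1) + 1} ∪ Set.Icc 1 ℓ := by
  ext j
  simp only [Finset.mem_coe, mem_lrcZeros, Set.mem_union, Set.mem_ofPred_eq, Set.mem_Icc,
    eq_comm (a := j)]

theorem mod_of_mem_lrcZeros {u r ℓ j : ℕ} (hℓ : 0 < ℓ) (hr : ℓ < r + 1)
    (hj : j ∈ lrcZeros u r ℓ) : 1 ≤ j % (r + 1) ∧ j % (r + 1) ≤ ℓ := by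
  obtain ⟨i, _, rfl⟩ | ⟨h1, h2⟩ := mem_lrcZeros.1 hj
  · rw [add_comm, Nat.add_mul_mod_self_right, Nat.mod_eq_of_lt (by lia)]
    lia
  · rw [Nat.mod_eq_of_lt (by lia)]
    exact ⟨h1, h2⟩

theorem lt_of_mem_lrcZeros {u r ℓ j : ℕ} (hu : 0 < u) (hℓ : 0 < ℓ) (hr : ℓ < r + 1)
    (hj : j ∈ lrcZeros u r ℓ) : j < u * (r + 1) := by
  obtain ⟨i, hi, rfl⟩ | ⟨h1, h2⟩ := mem_lrcZeros.1 hj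
  · nlinarith
  · nlinarith

theorem card_lrcZeros {u r ℓ : ℕ} (hu : 0 < u) (hℓ : 0 < ℓ) (hr : ℓ < r + 1) :
    (lrcZeros u r ℓ).card = u + ℓ - 1 := by
  -- The two pieces meet only in 1, since ℓ < r + 1; dropping it from the interval makes the union
  -- disjoint.
  have h : lrcZeros u r ℓ =
      (Finset.range u).image (fun i => i * (r + 1) + 1) ∪ Finset.Icc 2 ℓ := by
    ext j
    simp only [lrcZeros, Finset.mem_union, Finset.mem_image, Finset.mem_range, Finset.mem_Icc]
    refine or_congr_right' fun hj => ?_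
    have : j ≠ 1 := by
      rintro rfl
      exact hj ⟨0, hu, by simp⟩
    lia
  rw [h, Finset.card_union_of_disjoint, Finset.card_image_of_injective, Finset.card_range,
    Nat.card_Icc]
  · lia
  · intro i j hij
    simpa using hij
  · rw [Finset.disjoint_left]
    intro j hj hj'
    obtain ⟨i, _, rfl⟩ := Finset.mem_image.1 hj
    obtain ⟨h1, h2⟩ := Finset.mem_Icc.1 hj'
    obtain rfl | hi := Nat.eq_zero_or_pos i
    · lia
    · nlinarith

/-- Modulo r + 1 the two residues add up to something between 2 and 2ℓ, which is less than r + 1. -/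
theorem not_dvd_add_of_mem_lrcZeros {u r ℓ i j : ℕ} (hℓ : 0 < ℓ) (hr : 2 * ℓ < r + 1)
    (hi : i ∈ lrcZeros u r ℓ) (hj : j ∈ lrcZeros u r ℓ) : ¬ u * (r + 1) ∣ i + j := by
  intro h
  have h0 := Nat.mod_eq_zero_of_dvd ((Dvd.intro_left u rfl).trans h : r + 1 ∣ i + j)
  obtain ⟨h1, h2⟩ := mod_of_mem_lrcZeros hℓ (by lia) hi
  obtain ⟨h3, h4⟩ := mod_of_mem_lrcZeros hℓ (by lia) hj
  rw [Nat.add_mod, Nat.mod_eq_of_lt (by lia)] at h0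
  lia

theorem not_dvd_of_mem_lrcZeros {u r ℓ j : ℕ} (hℓ : 0 < ℓ) (hr : ℓ < r + 1)
    (hj : j ∈ lrcZeros u r ℓ) : ¬ u * (r + 1) ∣ j := by
  intro h
  have h0 := Nat.mod_eq_zero_of_dvd ((Dvd.intro_left u rfl).trans h : r + 1 ∣ j)
  have := mod_of_mem_lrcZeros hℓ hr hj
  lia

variable {F : Type*} [Field F]

theorem hasLocality_zeroCode_lrcZeros {u r : ℕ} (hu : 0 < u) (ℓ : ℕ) {α : F}
    (hα : IsPrimitiveRoot α (u * (r + 1))) :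
    HasLocality (zeroCode (u * (r + 1)) α (lrcZeros u r ℓ)) r := by
  intro i
  refine ⟨_, classWord_mem_dualCode hu hα r.succ_pos
    (fun i hi => mem_lrcZeros.2 (Or.inl ⟨i, hi, rfl⟩)) (Nat.mod_lt (i : ℕ) hu),
    card_supp_classWord_le α _, mem_supp.2 ?_⟩
  rw [classWord, if_pos rfl]
  exact pow_ne_zero _ (hα.ne_zero (by positivity))

/-- Raising α^(i(r+1)+1) to the power u gives α^u, so the factor j = 1 kills all these zeros at
once; α^j is killed by the j-th factor. -/
theorem sparseWord_mem_zeroCode_lrcZeros {u r ℓ : ℕ} (hu : 0 < u) (hℓ : 0 < ℓ) (hr : ℓ < r + 1)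
    {α : F} (hα : IsPrimitiveRoot α (u * (r + 1))) :
    sparseWord (u * (r + 1)) u ℓ α ∈ zeroCode (u * (r + 1)) α (lrcZeros u r ℓ) := by
  refine mem_zeroCode.2 fun j hj => ?_
  rw [eval_wordPoly_sparseWord _ _ (Nat.mul_lt_mul_of_pos_left hr hu)]
  obtain ⟨i, _, rfl⟩ | hj := mem_lrcZeros.1 hj
  · refine Finset.prod_eq_zero (Finset.mem_Icc.2 ⟨le_rfl, hℓ⟩) (sub_eq_zero.2 ?_)
    rw [← pow_mul, show (i * (r + 1) + 1) * u = u * (r + 1) * i + u by ring, pow_add, pow_mul,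
      hα.pow_eq_one, one_pow, one_mul, pow_one]
  · exact Finset.prod_eq_zero (Finset.mem_Icc.2 hj) (sub_eq_zero.2 (pow_right_comm _ _ _))

/-- Its pairing with the all-one word is ∏ (1 - α^(uj)), nonzero because α^u has order r + 1 > ℓ. -/
theorem sparseWord_notMem_dualCode {u r ℓ : ℕ} (hu : 0 < u) (hℓ : 0 < ℓ) (hr : ℓ < r + 1)
    {α : F} (hα : IsPrimitiveRoot α (u * (r + 1))) :
    sparseWord (u * (r + 1)) u ℓ α ∉ dualCode (zeroCode (u * (r + 1)) α (lrcZeros u r ℓ)) := by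
  intro h
  have h1 := h _ (one_mem_zeroCode hα fun i hi => not_dvd_of_mem_lrcZeros hℓ hr hi)
  have h2 := eval_wordPoly_sparseWord α 1 (Nat.mul_lt_mul_of_pos_left hr hu)
  rw [wordPoly_eval] at h2
  simp only [one_pow] at h2
  rw [h2] at h1
  obtain ⟨j, hj, h3⟩ := Finset.prod_eq_zero_iff.1 h1
  obtain ⟨hj1, hj2⟩ := Finset.mem_Icc.1 hj
  exact (hα.pow (by positivity) rfl).pow_ne_one_of_pos_of_lt (by lia) (hj2.trans_lt hr)
    (sub_eq_zero.1 h3).symm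

/-- The count of terms bounds the weight above; the BCH bound does so below, the word being nonzero
as it is not in the dual. -/
theorem card_supp_sparseWord {u r ℓ : ℕ} (hu : 0 < u) (hℓ : 0 < ℓ) (hr : ℓ < r + 1)
    {α : F} (hα : IsPrimitiveRoot α (u * (r + 1))) :
    (supp (sparseWord (u * (r + 1)) u ℓ α)).card = ℓ + 1 := by
  refine (card_supp_sparseWord_le hu α).antisymm (Nat.succ_le_of_lt ?_)
  by_contra! hle
  refine sparseWord_notMem_dualCode hu hℓ hr hα ?_
  rw [eq_zero_of_card_supp_le hα (fun j h1 h2 => mem_lrcZeros.2 (Or.inr ⟨h1, h2⟩))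
    (sparseWord_mem_zeroCode_lrcZeros hu hℓ hr hα) hle]
  exact zero_mem _

theorem exists_isPrimitiveRoot_of_dvd_card_sub_one [Fintype F] {n : ℕ}
    (h : n ∣ Fintype.card F - 1) : ∃ α : F, IsPrimitiveRoot α n := by
  obtain ⟨g, hg⟩ := _root_.IsCyclic.exists_ofOrder_eq_natCard (α := Fˣ)
  rw [Nat.card_units, Nat.card_eq_fintype_card] at hg
  obtain ⟨m, hm⟩ := h
  have hg' := IsPrimitiveRoot.coe_units_iff.2 (hg ▸ IsPrimitiveRoot.orderOf g)
  exact ⟨_, hg'.pow (Nat.sub_pos_of_lt Fintype.one_lt_card) (hm.trans (mul_comm _ _))⟩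

theorem ceil_natCast_div_eq {κ r u s : ℕ} (h : κ + s = u * r) (hs : s < r) :
    ⌈(κ : ℚ) / (r : ℚ)⌉ = (u : ℤ) := by
  have hr : (0 : ℚ) < r := by exact_mod_cast (Nat.zero_le s).trans_lt hs
  have h' : (κ : ℚ) + s = u * r := by exact_mod_cast h
  have hs' : (s : ℚ) < r := by exact_mod_cast hs
  have hs0 : (0 : ℚ) ≤ s := Nat.cast_nonneg s
  rw [Int.ceil_eq_iff, lt_div_iff₀ hr, div_le_iff₀ hr]
  push_cast
  constructor <;> linarith

end QLRC

/-! ### The main theorem -/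

theorem theorem4p5 (p : ℕ) [Fact p.Prime] (F : Type*) [Field F] [Fintype F] [Algebra (ZMod p) F]
    (q : ℕ) (hq : Fintype.card F = q) (u r ℓ : ℕ) (hu : 0 < u) (hr : 0 < r) (hℓ : 0 < ℓ)
    (hlt : u + 2 * ℓ < r + 2) (hdvd : u * (r + 1) ∣ q - 1) :
    ∃ (α : F) (C : Submodule F (Fin (u * (r + 1)) → F))
      (G : Subgroup (QLRC.Qudits F (u * (r + 1)) ≃ₗ[ℂ] QLRC.Qudits F (u * (r + 1)))) (κ δ : ℕ),
      -- the cyclic code behind the construction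
      QLRC.IsCyclicWithDefiningSet C α
        ({j : ℕ | ∃ i : ℕ, i < u ∧ j = i * (r + 1) + 1} ∪ Set.Icc 1 ℓ) ∧
      QLRC.dualCode C < C ∧
      QLRC.HasLocality C r ∧
      -- its quantum code
      QLRC.IsStabilizerGroup p G ∧
      QLRC.IsCSSGroup p C C G ∧
      -- the parameters and the locality of the quantum code
      (κ : ℤ) = (u : ℤ) * ((r : ℤ) - 1) - 2 * ((ℓ : ℤ) - 1) ∧
      δ = ℓ + 1 ∧
      QLRC.HasParameters p (QLRC.stabilizerCode G) κ δ ∧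
      QLRC.HasQuantumLocality p G r ∧
      -- equality in the Singleton-like bound
      2 * (δ : ℤ) = ((u * (r + 1) : ℕ) : ℤ) - (κ : ℤ) - 2 * ⌈(κ : ℚ) / (r : ℚ)⌉ + 4 := by
  open QLRC in
  subst hq
  obtain ⟨α, hα⟩ := exists_isPrimitiveRoot_of_dvd_card_sub_one hdvd
  have hℓr : ℓ < r + 1 := by lia
  have hlt' : ∀ j ∈ lrcZeros u r ℓ, j < u * (r + 1) :=
    fun j hj => lt_of_mem_lrcZeros hu hℓ hℓr hj
  have hle : dualCode (zeroCode (u * (r + 1)) α (lrcZeros u r ℓ)) ≤ zeroCode _ α _ :=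
    dualCode_zeroCode_le hα fun i hi j hj => not_dvd_add_of_mem_lrcZeros hℓ (by lia) hi hj
  have hs := sparseWord_mem_zeroCode_lrcZeros hu hℓ hℓr hα
  have hs' := sparseWord_notMem_dualCode hu hℓ hℓr hα
  have hloc := hasLocality_zeroCode_lrcZeros hu ℓ hα
  -- Writing κ as u * r - (u + 2 * ℓ - 2) suits the ceiling: `hlt` says exactly that the subtracted
  -- term is below `r`. The bound here keeps the natural subtraction exact.
  have hur : u + 2 * ℓ - 2 ≤ u * r := (show u + 2 * ℓ - 2 ≤ r by lia).trans
    (Nat.le_mul_of_pos_left r hu)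
  have hκ : u * r - (u + 2 * ℓ - 2) + (u + 2 * ℓ - 2) = u * r := Nat.sub_add_cancel hur
  have hκ' : ((u * r - (u + 2 * ℓ - 2) : ℕ) : ℤ) = (u : ℤ) * r - (u + 2 * ℓ - 2) := by
    rw [Nat.cast_sub hur, Nat.cast_sub (by lia)]
    push_cast
    ring
  refine ⟨α, zeroCode _ α (lrcZeros u r ℓ), cssGroup p _ hle, u * r - (u + 2 * ℓ - 2), ℓ + 1,
    coe_lrcZeros u r ℓ ▸ isCyclicWithDefiningSet_zeroCode hα hlt',
    lt_of_le_not_ge hle fun h => hs' (h hs), hloc, isStabilizerGroup_cssGroup p hle,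
    isCSSGroup_cssGroup p hle, ?_, rfl, ⟨?_, ?_⟩, hasQuantumLocality_cssGroup p hle hloc, ?_⟩
  · rw [hκ']
    ring
  -- The exponent is (n - |D|) - |D| with |D| = u + ℓ - 1.
  · rw [finrank_stabilizerCode_cssGroup, finrank_zeroCode hα hlt', finrank_dualCode_zeroCode hα hlt',
      card_lrcZeros hu hℓ hℓr, mul_add, mul_one]
    congr 1
    lia
  · exact hasMinDist_cssGroup p hle
      (fun c hc hw => eq_zero_of_card_supp_le hα
        (fun j h1 h2 => mem_lrcZeros.2 (Or.inr ⟨h1, h2⟩)) hc hw)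
      hs hs' (card_supp_sparseWord hu hℓ hℓr hα)
  · rw [ceil_natCast_div_eq hκ (by lia), hκ']
    push_cast
    ring
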